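/- Let $\mathbf X$ be a Polish space with its Borel $\sigma$-algebra, and for probability measures $m_1,m_2$ on $\mathbf X$ let $\|m_1-m_2\|_{TV}=\frac12\sup\{\int f\,dm_1-\int f\,dm_2 : f \text{ measurable},\ |f|\le 1\}$. Let $\mathcal P$ and $\mathcal P_\epsilon$ be Markov transition kernels on $\mathbf X$, and let $\alpha\in(0,1)$ and $\epsilon\in(0,\alpha)$ be such that \[ \|\mathcal P_\epsilon(x,\cdot)-\mathcal P(x,\cdot)\|_{TV}\le\epsilon \quad\text{and}\quad \|\mathcal P_\epsilon(x,\cdot)-\mathcal P(y,\cdot)\|_{TV}\le 1-\alpha\qquad\text{for all } x,y\in\mathbf X . \] Then for every probability measure $\nu$ on $\mathbf X\times\mathbf X$ there is a coupling $(X_n,X_n^\epsilon)_{n\ge0}$ of the two chains started from $\nu$, that is, random variables on one probability space such that $(X_0,X_0^\epsilon)$ has law $\nu$, and $(X_n)$ and $(X_n^\epsilon)$ are Markov chains with transition kernels $\mathcal P$ and $\mathcal P_\epsilon$ respectively (each with respect to the filtration generated by the pair process, hence also with respect to its own), for which the following hold. (i) For all $n\ge1$, \[ \frac1n\sum_{k=0}^{n-1}\mathbf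 P(X_k\ne X_k^\epsilon)\le\frac{\epsilon}{\alpha+\epsilon}+\frac{1-(1-\alpha-\epsilon)^n}{n(\alpha+\epsilon)}\Big(\mathbf P(X_0\ne X_0^\epsilon)-\frac{\epsilon}{\alpha+\epsilon}\Big). \] (ii) There is a finite real-valued random variable $K$ such that, with probability one, for all $n\ge1$, \[ \frac1n\sum_{k=0}^{n-1}\mathbf 1_{\{X_k\ne X_k^\epsilon\}}\le\frac{\epsilon}{\alpha+\epsilon}+\frac Kn+2\sqrt{\frac{\log n}{n}} . \] (iii) For all $n\ge1$, with $[x]^+=\max(x,0)$, \[ \mathbf E\Big(\Big[\frac1n\sum_{k=0}^{n-1}\mathbf 1_{\{X_k\ne X_k^\epsilon\}}-\frac{\epsilon}{\alpha+\epsilon}\Big]^+\Big)^2\le\frac{2}{n^2}\frac1{(\alpha+\epsilon)^2}+\frac2n\frac{\alpha^2}{(\alpha+\epsilon)^4}. \] (iv) For all $n\ge1$ and all $\lambda>0$, \[ \mathbf P\Big(\frac1n\sum_{k=0}^{n-1}\mathbf 1_{\{X_k\ne X_k^\epsilon\}}\ge\frac{\epsilon}{\alpha+\epsilon}+\frac{\mathbf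 1_{\{X_0\ne X_0^\epsilon\}}}{n(\alpha+\epsilon)}+\frac{\lambda}{\sqrt n}\Big)\le e^{-\frac{(\alpha+\epsilon)^2}{2}\lambda^2}. \] -/

import Mathlib

open MeasureTheory ProbabilityTheory

universe u v

noncomputable section

/-- Total variation distance of two probability measures,
`(1/2) * sup { μ f - ν f : f measurable, |f| ≤ 1 }`. -/
def tvDist {E : Type u} [MeasurableSpace E] (μ ν : Measure E) : ℝ :=
  (1 / 2) * sSup {r : ℝ | ∃ f : E → ℝ, Measurable f ∧ (∀ x, |f x| ≤ 1) ∧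
    r = ∫ x, f x ∂μ - ∫ x, f x ∂ν}

/-- The σ-algebra generated by `(X 0, Y 0), …, (X n, Y n)`. -/
@[reducible] def pairPast {Ω : Type v} {E : Type u} [MeasurableSpace E] (X Y : ℕ → Ω → E) (n : ℕ) :
    MeasurableSpace Ω :=
  ⨆ k ≤ n, MeasurableSpace.comap (fun ω => (X k ω, Y k ω)) inferInstance

/-- `(X, Y)` is a coupling, on the probability space `(Ω, μ)`, of the Markov chain with transition
kernel `κ` and the Markov chain with transition kernel `η`, with initial pair of law `ν`.
The Markov property of each chain is required with respect to the common past of the pair; by the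
tower property each chain is then also Markov with respect to its own past, so that
its path law is the usual one. -/
structure IsChainCoupling {Ω : Type v} [MeasurableSpace Ω] (μ : Measure Ω)
    {E : Type u} [MeasurableSpace E] (κ η : Kernel E E) (ν : Measure (E × E))
    (X Y : ℕ → Ω → E) : Prop where
  measurable_left : ∀ n, Measurable (X n)
  measurable_right : ∀ n, Measurable (Y n)
  map_init : μ.map (fun ω => (X 0 ω, Y 0 ω)) = ν
  markov_left : ∀ (n : ℕ) (A : Set E), MeasurableSet A →
    μ[(X (n + 1) ⁻¹' A).indicator (fun _ => (1 : ℝ)) | pairPast X Y n]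
      =ᵐ[μ] fun ω => (κ (X n ω)).real A
  markov_right : ∀ (n : ℕ) (A : Set E), MeasurableSet A →
    μ[(Y (n + 1) ⁻¹' A).indicator (fun _ => (1 : ℝ)) | pairPast X Y n]
      =ᵐ[μ] fun ω => (η (Y n ω)).real A

/-- The indicator of the event that the two chains disagree at time `k`. -/
def disagree {Ω : Type v} {E : Type u} (X Y : ℕ → Ω → E) (k : ℕ) (ω : Ω) : ℝ :=
  {ω' | X k ω' ≠ Y k ω'}.indicator (fun _ => (1 : ℝ)) ω

/-- The fraction of the times `0, …, n - 1` at which the two chains disagree. -/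
def disagreeFrac {Ω : Type v} {E : Type u} (X Y : ℕ → Ω → E) (n : ℕ) (ω : Ω) : ℝ :=
  (1 / (n : ℝ)) * ∑ k ∈ Finset.range n, disagree X Y k ω

end

/-!
The minimum of `P x` and `Pε y` and the two positive parts of their difference depend measurably on
`(x, y)`, so their maximal coupling is a kernel; under it the two coordinates differ with
probability at most the total variation distance of `P x` and `Pε y`.
Run the pair chain with this kernel. If the chains agree at time `k`, they disagree at time `k + 1`
with probability at most `ε`; otherwise with probability at most `1 - α`. The indicator `D k` of
disagreement thus satisfies `E[D (k + 1) | ℱ k] ≤ ε + (1 - α - ε) * D k`.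

Taking expectations gives (i). Summing instead along a path, the Doob decomposition of `D` bounds
`(α + ε) * ∑ k < n, D k` by `n * ε` plus a martingale `M n` with increments at most `1` in absolute
value. Azuma's inequality for `M` gives (iv), orthogonality of its increments, each of variance at
most `1 / 4`, gives (iii), and Doob's maximal inequality on dyadic blocks gives (ii).
-/

section TotalVariation

variable {E : Type*} [MeasurableSpace E] (μ ν : Measure E)

theorem tvDist_comm : tvDist μ ν = tvDist ν μ := by
  suffices h : ∀ (μ ν : Measure E) (r : ℝ),
      (∃ f : E → ℝ, Measurable f ∧ (∀ x, |f x| ≤ 1) ∧ r = ∫ x, f x ∂μ - ∫ x, f x ∂ν) →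
      ∃ f : E → ℝ, Measurable f ∧ (∀ x, |f x| ≤ 1) ∧ r = ∫ x, f x ∂ν - ∫ x, f x ∂μ by
    rw [tvDist, tvDist, Set.ext fun r => ⟨h μ ν r, h ν μ r⟩]
  rintro μ ν r ⟨f, hf, hf1, rfl⟩
  refine ⟨fun x => -f x, hf.neg, by simpa using hf1, ?_⟩
  rw [integral_neg, integral_neg]
  ring

theorem integral_sub_integral_le_two_mul_tvDist [IsFiniteMeasure μ] [IsFiniteMeasure ν]
    {f : E → ℝ} (hf : Measurable f) (hf1 : ∀ x, |f x| ≤ 1) :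
    ∫ x, f x ∂μ - ∫ x, f x ∂ν ≤ 2 * tvDist μ ν := by
  have abs_integral_le (m : Measure E) [IsFiniteMeasure m] (g : E → ℝ) (hg : ∀ x, |g x| ≤ 1) :
      |∫ x, g x ∂m| ≤ m.real Set.univ := by
    simpa using norm_integral_le_of_norm_le_const (μ := m) (f := g) (C := 1) (.of_forall hg)
  have bounded : BddAbove {r : ℝ | ∃ g : E → ℝ, Measurable g ∧ (∀ x, |g x| ≤ 1) ∧
      r = ∫ x, g x ∂μ - ∫ x, g x ∂ν} := by
    refine ⟨μ.real Set.univ + ν.real Set.univ, ?_⟩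
    rintro r ⟨g, -, hg, rfl⟩
    exact (le_abs_self _).trans <| (abs_sub _ _).trans <|
      add_le_add (abs_integral_le μ g hg) (abs_integral_le ν g hg)
  rw [tvDist, ← mul_assoc, mul_one_div_cancel two_ne_zero, one_mul]
  exact le_csSup bounded ⟨f, hf, hf1, rfl⟩

theorem measureReal_sub_le_tvDist [IsProbabilityMeasure μ] [IsProbabilityMeasure ν] {B : Set E}
    (hB : MeasurableSet B) : μ.real B - ν.real B ≤ tvDist μ ν := by
  have integral_sign (m : Measure E) [IsProbabilityMeasure m] :
      ∫ x, (B.indicator (fun _ => (2 : ℝ)) x - 1) ∂m = 2 * m.real B - 1 := by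
    rw [integral_sub ((integrable_const _).indicator hB) (integrable_const _),
      integral_indicator_const _ hB]
    simp [mul_comm]
  have h := integral_sub_integral_le_two_mul_tvDist μ ν
    (f := fun x => B.indicator (fun _ => (2 : ℝ)) x - 1)
    ((measurable_const.indicator hB).sub_const 1)
    fun x => by by_cases hx : x ∈ B <;> norm_num [hx]
  rw [integral_sign, integral_sign] at h
  linarith

end TotalVariation

section MaximalCoupling

variable {α γ : Type*} [MeasurableSpace α] [MeasurableSpace γ]
  [MeasurableSpace.CountableOrCountablyGenerated α γ]

/-- The minimum `κ ∧ η` of two kernels, given by the pointwise minimum of their densities with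
respect to `κ + η`. -/
noncomputable def overlapKernel (κ η : Kernel α γ) [IsSFiniteKernel κ] [IsSFiniteKernel η] :
    Kernel α γ :=
  (κ + η).withDensity fun a x => min (κ.rnDeriv (κ + η) a x) (η.rnDeriv (κ + η) a x)

/-- The positive part `(κ - η)⁺` of the difference of two kernels, given by the truncated
difference of their densities with respect to `κ + η`. -/
noncomputable def excessKernel (κ η : Kernel α γ) [IsSFiniteKernel κ] [IsSFiniteKernel η] :
    Kernel α γ :=
  (κ + η).withDensity fun a x => κ.rnDeriv (κ + η) a x - η.rnDeriv (κ + η) a x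

theorem overlapKernel_comm (κ η : Kernel α γ) [IsSFiniteKernel κ] [IsSFiniteKernel η] :
    overlapKernel κ η = overlapKernel η κ := by
  simp_rw [overlapKernel, add_comm η κ, min_comm]

section Finite

variable (κ η : Kernel α γ) [IsFiniteKernel κ] [IsFiniteKernel η]

theorem withDensity_rnDeriv_add_left : (κ + η).withDensity (κ.rnDeriv (κ + η)) = κ := by
  ext1 a
  refine Kernel.withDensity_rnDeriv_eq (Measure.absolutelyContinuous_of_le ?_)
  exact Measure.le_add_right le_rfl

theorem overlapKernel_add_excessKernel : overlapKernel κ η + excessKernel κ η = κ := by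
  have hκ := Kernel.measurable_rnDeriv κ (κ + η)
  have hη := Kernel.measurable_rnDeriv η (κ + η)
  rw [overlapKernel, excessKernel, ← Kernel.withDensity_add_right (hκ.min hη) (hκ.sub hη)]
  convert withDensity_rnDeriv_add_left κ η using 2
  ext a x
  exact (add_comm _ _).trans tsub_add_min

instance : IsFiniteKernel (overlapKernel κ η) :=
  isFiniteKernel_of_le (ν := κ) fun a => by
    conv_rhs => rw [← overlapKernel_add_excessKernel κ η]
    exact Measure.le_add_right le_rfl

instance : IsFiniteKernel (excessKernel κ η) :=
  isFiniteKernel_of_le (ν := κ) fun a => by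
    conv_rhs => rw [← overlapKernel_add_excessKernel κ η]
    exact Measure.le_add_left le_rfl

theorem overlapKernel_add_excessKernel_apply (a : α) (s : Set γ) :
    overlapKernel κ η a s + excessKernel κ η a s = κ a s := by
  conv_rhs => rw [← overlapKernel_add_excessKernel κ η]
  rfl

theorem overlapKernel_add_excessKernel_swap_apply (a : α) (s : Set γ) :
    overlapKernel κ η a s + excessKernel η κ a s = η a s := by
  rw [overlapKernel_comm, overlapKernel_add_excessKernel_apply]

theorem excessKernel_apply_eq_zero (a : α) {s : Set γ} (hs : MeasurableSet s)
    (hle : ∀ x ∈ s, κ.rnDeriv (κ + η) a x ≤ η.rnDeriv (κ + η) a x) : excessKernel κ η a s = 0 := by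
  rw [excessKernel, Kernel.withDensity_apply' _
    ((Kernel.measurable_rnDeriv κ _).sub (Kernel.measurable_rnDeriv η _))]
  exact setLIntegral_eq_zero hs fun x hx => tsub_eq_zero_of_le (hle x hx)

end Finite

section Markov

variable (κ η : Kernel α γ) [IsMarkovKernel κ] [IsMarkovKernel η]

theorem excessKernel_apply_univ_comm (a : α) :
    excessKernel κ η a Set.univ = excessKernel η κ a Set.univ := by
  refine (ENNReal.add_right_inj (measure_ne_top (overlapKernel κ η a) Set.univ)).1 ?_
  rw [overlapKernel_add_excessKernel_apply, overlapKernel_add_excessKernel_swap_apply,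
    measure_univ, measure_univ]

theorem excessKernel_real_univ_le_tvDist (a : α) :
    (excessKernel κ η a).real Set.univ ≤ tvDist (κ a) (η a) := by
  set B : Set γ := {x | η.rnDeriv (κ + η) a x ≤ κ.rnDeriv (κ + η) a x}
  have hB : MeasurableSet B := measurableSet_le
    ((Kernel.measurable_rnDeriv η (κ + η)).comp measurable_prodMk_left)
    ((Kernel.measurable_rnDeriv κ (κ + η)).comp measurable_prodMk_left)
  have off_B : excessKernel κ η a Bᶜ = 0 :=
    excessKernel_apply_eq_zero κ η a hB.compl fun x hx => le_of_not_ge (by exact hx)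
  have on_B : excessKernel η κ a B = 0 :=
    excessKernel_apply_eq_zero η κ a hB fun x hx => by rwa [add_comm]
  have hκ : κ a B = overlapKernel κ η a B + excessKernel κ η a Set.univ := by
    rw [← measure_add_measure_compl hB, off_B, add_zero, overlapKernel_add_excessKernel_apply]
  have hη : η a B = overlapKernel κ η a B := by
    rw [← overlapKernel_add_excessKernel_swap_apply κ η, on_B, add_zero]
  calc (excessKernel κ η a).real Set.univ = (κ a).real B - (η a).real B := by
        rw [measureReal_def, measureReal_def, measureReal_def, hκ, hη,
          ENNReal.toReal_add (measure_ne_top _ _) (measure_ne_top _ _), add_sub_cancel_left]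
    _ ≤ tvDist (κ a) (η a) := measureReal_sub_le_tvDist _ _ hB

end Markov

/-- The maximal coupling of two kernels: the overlap is transported by the diagonal, and the two
excesses are made independent. They have the same mass, which the density normalises away once;
where that mass is zero so are the excesses, and the density is irrelevant. -/
noncomputable def maximalCoupling (κ η : Kernel α γ) [IsSFiniteKernel κ] [IsSFiniteKernel η] :
    Kernel α (γ × γ) :=
  (overlapKernel κ η).map (fun x => (x, x)) +
    (excessKernel κ η ×ₖ excessKernel η κ).withDensity fun a _ => (excessKernel κ η a Set.univ)⁻¹

section MarkovCoupling

variable (κ η : Kernel α γ) [IsMarkovKernel κ] [IsMarkovKernel η]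

theorem maximalCoupling_apply (a : α) {s : Set (γ × γ)} (hs : MeasurableSet s) :
    maximalCoupling κ η a s = overlapKernel κ η a {x | (x, x) ∈ s} +
      (excessKernel κ η a Set.univ)⁻¹ * (excessKernel κ η ×ₖ excessKernel η κ) a s := by
  have hdens : Measurable (Function.uncurry fun (a : α) (_ : γ × γ) =>
      (excessKernel κ η a Set.univ)⁻¹) :=
    ((Kernel.measurable_coe _ MeasurableSet.univ).comp measurable_fst).inv
  rw [maximalCoupling, add_apply, Measure.add_apply, Kernel.map_apply' _ (by fun_prop) _ hs,
    Kernel.withDensity_apply' _ hdens, setLIntegral_const]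
  rfl

theorem maximalCoupling_fst : (maximalCoupling κ η).fst = κ := by
  ext a s hs
  have hcancel : (excessKernel κ η a Set.univ)⁻¹ *
      (excessKernel κ η a Set.univ * excessKernel κ η a s) = excessKernel κ η a s :=
    ENNReal.inv_mul_cancel_left' (measure_mono_null s.subset_univ)
      fun h => (measure_ne_top _ _ h).elim
  rw [Kernel.fst_apply' _ _ hs]
  change maximalCoupling κ η a (Prod.fst ⁻¹' s) = _
  rw [← Set.prod_univ, maximalCoupling_apply κ η a (hs.prod .univ),
    Kernel.prod_apply_prod, ← excessKernel_apply_univ_comm κ η, mul_comm (excessKernel κ η a s),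
    hcancel, ← overlapKernel_add_excessKernel_apply κ η]
  simp

theorem maximalCoupling_snd : (maximalCoupling κ η).snd = η := by
  ext a s hs
  have hcancel : (excessKernel κ η a Set.univ)⁻¹ *
      (excessKernel κ η a Set.univ * excessKernel η κ a s) = excessKernel η κ a s := by
    rw [excessKernel_apply_univ_comm κ η]
    exact ENNReal.inv_mul_cancel_left' (measure_mono_null s.subset_univ)
      fun h => (measure_ne_top _ _ h).elim
  rw [Kernel.snd_apply' _ _ hs]
  change maximalCoupling κ η a (Prod.snd ⁻¹' s) = _
  rw [← Set.univ_prod, maximalCoupling_apply κ η a (MeasurableSet.univ.prod hs),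
    Kernel.prod_apply_prod, hcancel, ← overlapKernel_add_excessKernel_swap_apply κ η]
  simp

instance : IsMarkovKernel (maximalCoupling κ η) where
  isProbabilityMeasure a := ⟨by
    simpa [maximalCoupling_fst] using (Kernel.fst_apply' (maximalCoupling κ η) a .univ).symm⟩

theorem maximalCoupling_real_ne_le_tvDist [MeasurableEq γ] (a : α) :
    (maximalCoupling κ η a).real {p | p.1 ≠ p.2} ≤ tvDist (κ a) (η a) := by
  have hne : MeasurableSet {p : γ × γ | p.1 ≠ p.2} :=
    (measurableSet_eq_fun measurable_fst measurable_snd).compl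
  have hle : maximalCoupling κ η a {p | p.1 ≠ p.2} ≤ excessKernel κ η a Set.univ := by
    rw [maximalCoupling_apply κ η a hne]
    calc _ = (excessKernel κ η a Set.univ)⁻¹ *
          (excessKernel κ η ×ₖ excessKernel η κ) a {p | p.1 ≠ p.2} := by simp
      _ ≤ (excessKernel κ η a Set.univ)⁻¹ *
          (excessKernel κ η ×ₖ excessKernel η κ) a (Set.univ ×ˢ Set.univ) := by
        gcongr
        simp
      _ = excessKernel κ η a Set.univ := by
        rw [Kernel.prod_apply_prod, ← excessKernel_apply_univ_comm κ η]
        exact ENNReal.inv_mul_cancel_left' id fun h => (measure_ne_top _ _ h).elim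
  exact (ENNReal.toReal_mono (measure_ne_top _ _) hle).trans
    (excessKernel_real_univ_le_tvDist κ η a)

end MarkovCoupling

end MaximalCoupling

section PathSpace

theorem condExp_indicator_ae_eq_of_compProd_eq_map {Ω S T : Type*} [MeasurableSpace Ω]
    [MeasurableSpace S] [MeasurableSpace T] {μ : Measure Ω} [IsFiniteMeasure μ] {Z : Ω → T}
    {Y : Ω → S} {κ : Kernel T S} [IsFiniteKernel κ] (hZ : Measurable Z) (hY : Measurable Y)
    (hlaw : μ.map Z ⊗ₘ κ = μ.map fun ω => (Z ω, Y ω)) {B : Set S} (hB : MeasurableSet B) :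
    μ[(Y ⁻¹' B).indicator (fun _ => (1 : ℝ)) | MeasurableSpace.comap Z inferInstance]
      =ᵐ[μ] fun ω => (κ (Z ω)).real B := by
  have hκB : Measurable fun z => (κ z).real B := (Kernel.measurable_coe κ hB).ennreal_toReal
  have hint : Integrable (fun ω => (κ (Z ω)).real B) μ :=
    .of_bound (hκB.comp hZ).aestronglyMeasurable κ.bound.toReal <| .of_forall fun ω => by
      rw [Real.norm_of_nonneg measureReal_nonneg]
      exact ENNReal.toReal_mono κ.bound_ne_top (κ.measure_le_bound _ _)
  refine (ae_eq_condExp_of_forall_setIntegral_eq hZ.comap_le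
    ((integrable_const _).indicator (hY hB)) (fun _ _ _ => hint.integrableOn) ?_
    (hκB.comp (comap_measurable Z)).aestronglyMeasurable).symm
  rintro _ ⟨t, ht, rfl⟩ -
  have hrect : ∫⁻ ω in Z ⁻¹' t, κ (Z ω) B ∂μ = μ (Z ⁻¹' t ∩ Y ⁻¹' B) := by
    rw [← setLIntegral_map ht (Kernel.measurable_coe κ hB) hZ, ← Measure.compProd_apply_prod ht hB,
      hlaw, Measure.map_apply (hZ.prodMk hY) (ht.prod hB)]
    rfl
  calc ∫ ω in Z ⁻¹' t, (κ (Z ω)).real B ∂μ = (∫⁻ ω in Z ⁻¹' t, κ (Z ω) B ∂μ).toReal := by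
        exact integral_toReal ((Kernel.measurable_coe κ hB).comp hZ).aemeasurable
          (.of_forall fun ω => measure_lt_top _ _)
    _ = ∫ ω in Z ⁻¹' t, (Y ⁻¹' B).indicator (fun _ => (1 : ℝ)) ω ∂μ := by
        rw [hrect, setIntegral_indicator (hY hB), setIntegral_const, smul_eq_mul, mul_one]
        rfl

variable {S : Type*} [MeasurableSpace S]

/-- The law on path space of the Markov chain with transition kernel `Q` and initial law `ν`. -/
noncomputable def markovPathMeasure (Q : Kernel S S) [IsMarkovKernel Q] (ν : Measure S) :
    Measure (ℕ → S) :=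
  Kernel.trajMeasure (X := fun _ => S) ν fun n =>
    Q.comap (fun h => h ⟨n, by simp⟩) (measurable_pi_apply _)

instance (Q : Kernel S S) [IsMarkovKernel Q] (ν : Measure S) [IsProbabilityMeasure ν] :
    IsProbabilityMeasure (markovPathMeasure Q ν) := by
  unfold markovPathMeasure
  infer_instance

theorem measurable_eval_piLE (n : ℕ) :
    Measurable[Filtration.piLE (X := fun _ => S) n] fun ω : ℕ → S => ω n := by
  rw [Filtration.piLE_eq_comap_frestrictLe]
  exact (measurable_pi_apply (⟨n, by simp⟩ : Finset.Iic n)).comp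
    (comap_measurable (Preorder.frestrictLe (π := fun _ => S) n))

variable (Q : Kernel S S) [IsMarkovKernel Q] (ν : Measure S)

theorem markovPathMeasure_map_eval_zero : (markovPathMeasure Q ν).map (fun ω => ω 0) = ν := by
  have hfr : Measurable (Preorder.frestrictLe (π := fun _ : ℕ => S) 0) :=
    Preorder.measurable_frestrictLe 0
  have heval : Measurable fun h : (i : Finset.Iic 0) → S => h ⟨0, by simp⟩ :=
    measurable_pi_apply _
  have hcomp : (fun ω : ℕ → S => ω 0) =
      (fun h : (i : Finset.Iic 0) → S => h ⟨0, by simp⟩) ∘ Preorder.frestrictLe 0 := rfl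
  rw [hcomp, ← Measure.map_map heval hfr, markovPathMeasure, Kernel.trajMeasure,
    Measure.map_comp _ _ hfr, Kernel.traj_map_frestrictLe, Kernel.partialTraj_self,
    Measure.id_comp, Measure.map_map heval (by fun_prop)]
  exact Measure.map_id

theorem markovPathMeasure_condExp_succ [IsProbabilityMeasure ν] (n : ℕ) {B : Set S}
    (hB : MeasurableSet B) :
    (markovPathMeasure Q ν)[((fun ω : ℕ → S => ω (n + 1)) ⁻¹' B).indicator (fun _ => (1 : ℝ)) |
        Filtration.piLE (X := fun _ => S) n]
      =ᵐ[markovPathMeasure Q ν] fun ω => (Q (ω n)).real B := by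
  rw [Filtration.piLE_eq_comap_frestrictLe]
  exact condExp_indicator_ae_eq_of_compProd_eq_map (Preorder.measurable_frestrictLe n)
    (measurable_pi_apply (n + 1)) Kernel.map_frestrictLe_trajMeasure_compProd_eq_map_trajMeasure hB

end PathSpace

section PairChain

variable {E : Type*} [MeasurableSpace E]

theorem pairPast_eval_eq_piLE (n : ℕ) :
    pairPast (fun k (ω : ℕ → E × E) => (ω k).1) (fun k ω => (ω k).2) n =
      Filtration.piLE (X := fun _ => E × E) n := by
  refine le_antisymm (iSup₂_le fun k hk => ?_) ?_
  · exact ((measurable_eval_piLE k).mono (Filtration.piLE.mono hk) le_rfl).comap_le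
  · rw [Filtration.piLE_eq_comap_frestrictLe]
    refine Measurable.comap_le (@measurable_pi_lambda _ _ _ (_) _ _ fun i => ?_)
    refine (comap_measurable fun ω : ℕ → E × E => ω i).mono ?_ le_rfl
    exact le_iSup₂_of_le (f := fun k (_ : k ≤ n) => MeasurableSpace.comap
      (fun ω : ℕ → E × E => ((ω k).1, (ω k).2)) inferInstance) (i : ℕ) (Finset.mem_Iic.1 i.2) le_rfl

theorem isChainCoupling_markovPathMeasure {κ η : Kernel E E} {Q : Kernel (E × E) (E × E)}
    [IsMarkovKernel Q] (hfst : Q.fst = κ.comap Prod.fst measurable_fst)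
    (hsnd : Q.snd = η.comap Prod.snd measurable_snd)
    (ν : Measure (E × E)) [IsProbabilityMeasure ν] :
    IsChainCoupling (markovPathMeasure Q ν) κ η ν (fun k ω => (ω k).1) (fun k ω => (ω k).2) where
  measurable_left n := (measurable_pi_apply n).fst
  measurable_right n := (measurable_pi_apply n).snd
  map_init := markovPathMeasure_map_eval_zero Q ν
  markov_left n A hA := by
    rw [pairPast_eval_eq_piLE]
    refine (markovPathMeasure_condExp_succ Q ν n (measurable_fst hA)).trans
      (.of_forall fun ω => congrArg ENNReal.toReal ?_)
    exact (Kernel.fst_apply' Q (ω n) hA).symm.trans (by rw [hfst, Kernel.comap_apply])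
  markov_right n A hA := by
    rw [pairPast_eval_eq_piLE]
    refine (markovPathMeasure_condExp_succ Q ν n (measurable_snd hA)).trans
      (.of_forall fun ω => congrArg ENNReal.toReal ?_)
    exact (Kernel.snd_apply' Q (ω n) hA).symm.trans (by rw [hsnd, Kernel.comap_apply])

end PairChain

section SquareIntegrable

variable {Ω : Type*} {m mΩ : MeasurableSpace Ω} {μ : Measure Ω}

theorem integral_mul_eq_zero_of_condExp_eq_zero [IsFiniteMeasure μ] (hm : m ≤ mΩ) {X Z : Ω → ℝ}
    (hZ : StronglyMeasurable[m] Z) (hX : Integrable X μ) (hZX : Integrable (Z * X) μ)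
    (h0 : μ[X | m] =ᵐ[μ] 0) : ∫ ω, Z ω * X ω ∂μ = 0 := by
  have hpull : μ[Z * X | m] =ᵐ[μ] 0 := by
    filter_upwards [condExp_mul_of_stronglyMeasurable_left hZ hZX hX, h0] with ω h₁ h₂
    rw [h₁, Pi.mul_apply, h₂, Pi.zero_apply, mul_zero]
  calc ∫ ω, Z ω * X ω ∂μ = ∫ ω, (μ[Z * X | m]) ω ∂μ := (integral_condExp hm).symm
    _ = 0 := integral_eq_zero_of_ae hpull

theorem integral_sub_condExp_sq_le_variance [IsProbabilityMeasure μ] (hm : m ≤ mΩ) {X : Ω → ℝ}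
    (hX : MemLp X 2 μ) : ∫ ω, (X ω - (μ[X | m]) ω) ^ 2 ∂μ ≤ variance X μ := by
  calc ∫ ω, (X ω - (μ[X | m]) ω) ^ 2 ∂μ = ∫ ω, (condVar m X μ) ω ∂μ := (integral_condExp hm).symm
    _ ≤ variance X μ := by
        rw [← integral_condVar_add_variance_condExp hm hX]
        exact le_add_of_nonneg_right (variance_nonneg _ _)

variable {ℱ : Filtration ℕ mΩ} {M : ℕ → Ω → ℝ}

theorem condExp_succ_sub_ae_eq_zero (hM : Martingale M ℱ μ) (k : ℕ) :
    μ[M (k + 1) - M k | ℱ k] =ᵐ[μ] 0 := by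
  filter_upwards [condExp_sub (hM.integrable (k + 1)) (hM.integrable k) (ℱ k),
    hM.2 k (k + 1) k.le_succ, hM.2 k k le_rfl] with ω h₁ h₂ h₃
  rw [h₁, Pi.sub_apply, h₂, h₃, sub_self, Pi.zero_apply]

theorem integral_sq_martingale [IsFiniteMeasure μ] (hM : Martingale M ℱ μ)
    (h2 : ∀ n, MemLp (M n) 2 μ) (n : ℕ) :
    ∫ ω, M n ω ^ 2 ∂μ =
      ∫ ω, M 0 ω ^ 2 ∂μ + ∑ k ∈ Finset.range n, ∫ ω, (M (k + 1) ω - M k ω) ^ 2 ∂μ := by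
  induction n with
  | zero => simp
  | succ n ih =>
    have hdiff : MemLp (M (n + 1) - M n) 2 μ := (h2 (n + 1)).sub (h2 n)
    have hsq : Integrable (fun ω => M n ω ^ 2) μ := (h2 n).integrable_sq
    have hdiffsq : Integrable (fun ω => (M (n + 1) ω - M n ω) ^ 2) μ := hdiff.integrable_sq
    have hcross : Integrable (fun ω => M n ω * (M (n + 1) ω - M n ω)) μ :=
      (h2 n).integrable_mul hdiff
    have horth : ∫ ω, M n ω * (M (n + 1) ω - M n ω) ∂μ = 0 :=
      integral_mul_eq_zero_of_condExp_eq_zero (ℱ.le n) (hM.1 n)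
        (hdiff.integrable one_le_two) hcross (condExp_succ_sub_ae_eq_zero hM n)
    calc ∫ ω, M (n + 1) ω ^ 2 ∂μ
        = ∫ ω, (M n ω ^ 2 + 2 * (M n ω * (M (n + 1) ω - M n ω)) +
            (M (n + 1) ω - M n ω) ^ 2) ∂μ := by
          congr with ω
          ring
      _ = ∫ ω, M n ω ^ 2 ∂μ + 2 * ∫ ω, M n ω * (M (n + 1) ω - M n ω) ∂μ +
            ∫ ω, (M (n + 1) ω - M n ω) ^ 2 ∂μ := by
          rw [← integral_const_mul, ← integral_add hsq (hcross.const_mul 2)]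
          exact integral_add (hsq.add (hcross.const_mul 2)) hdiffsq
      _ = _ := by rw [horth, mul_zero, add_zero, ih, Finset.sum_range_succ, add_assoc]

end SquareIntegrable

section SubgaussianMartingale

open Finset NNReal

variable {Ω : Type*} {m mΩ : MeasurableSpace Ω} {μ : Measure Ω}

theorem hasCondSubgaussianMGF_of_mem_Icc_of_condExp_eq_zero [StandardBorelSpace Ω]
    [IsFiniteMeasure μ] (hm : m ≤ mΩ) {X : Ω → ℝ} {a b : ℝ} (hX : AEMeasurable X μ)
    (hab : ∀ᵐ ω ∂μ, X ω ∈ Set.Icc a b) (h0 : μ[X | m] =ᵐ[μ] 0) :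
    HasCondSubgaussianMGF m hm X ((‖b - a‖₊ / 2) ^ 2) μ where
  integrable_exp_mul t := by
    rw [condExpKernel_comp_trim]
    exact integrable_exp_mul_of_mem_Icc hX hab
  mgf_le := by
    have hab' : ∀ᵐ ω ∂μ.trim hm, ∀ᵐ ω' ∂condExpKernel μ m ω, X ω' ∈ Set.Icc a b :=
      Measure.ae_ae_of_ae_comp (by rwa [condExpKernel_comp_trim])
    have hX' : ∀ᵐ ω ∂μ.trim hm, AEMeasurable X (condExpKernel μ m ω) := by
      filter_upwards [Measure.ae_ae_of_ae_comp (κ := condExpKernel μ m) (μ := μ.trim hm)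
        (p := fun ω => X ω = hX.mk X ω) (by rw [condExpKernel_comp_trim]; exact hX.ae_eq_mk)]
        with ω hω
      exact ⟨hX.mk X, hX.measurable_mk, hω⟩
    have hmean : ∀ᵐ ω ∂μ.trim hm, ∫ ω', X ω' ∂condExpKernel μ m ω = 0 := by
      filter_upwards [condExp_ae_eq_trim_integral_condExpKernel hm (.of_mem_Icc a b hX hab),
        stronglyMeasurable_condExp.ae_eq_trim_of_stronglyMeasurable hm stronglyMeasurable_zero h0]
        with ω h₁ h₂
      rw [← h₁, h₂, Pi.zero_apply]
    filter_upwards [hab', hX', hmean] with ω h₁ h₂ h₃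
    exact (hasSubgaussianMGF_of_mem_Icc_of_integral_eq_zero h₂ h₁ h₃).mgf_le

variable {ℱ : Filtration ℕ mΩ} {M : ℕ → Ω → ℝ}

theorem hasSubgaussianMGF_sub_of_abs_sub_le [StandardBorelSpace Ω] [IsProbabilityMeasure μ]
    (hM : Martingale M ℱ μ) {c : ℕ → ℝ≥0}
    (hc : ∀ k, ∀ᵐ ω ∂μ, |M (k + 1) ω - M k ω| ≤ c k) (n : ℕ) :
    HasSubgaussianMGF (M n - M 0) (∑ k ∈ range n, c k ^ 2) μ := by
  have hcond (k : ℕ) : HasCondSubgaussianMGF (ℱ k) (ℱ.le k) (M (k + 1) - M k) (c k ^ 2) μ := by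
    have hmeas : AEMeasurable (M (k + 1) - M k) μ :=
      ((hM.integrable (k + 1)).sub (hM.integrable k)).aemeasurable
    have hwidth : (‖(c k : ℝ) - -(c k : ℝ)‖₊ / 2) ^ 2 = c k ^ 2 := by
      rw [sub_neg_eq_add, ← two_mul, nnnorm_mul]
      simp
    rw [← hwidth]
    exact hasCondSubgaussianMGF_of_mem_Icc_of_condExp_eq_zero (ℱ.le k) hmeas
      ((hc k).mono fun ω => abs_le.1) (condExp_succ_sub_ae_eq_zero hM k)
  induction n with
  | zero => simp
  | succ n ih =>
    have hadapted : Measurable[ℱ n] (M n - M 0) :=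
      (hM.1 n).measurable.sub ((hM.1 0).measurable.mono (ℱ.mono n.zero_le) le_rfl)
    rw [sum_range_succ, ← sub_add_sub_cancel' (M n)]
    exact (ih.trim (ℱ.le n) hadapted).add_of_hasCondSubgaussianMGF (ℱ.le n) (hcond n)

theorem submartingale_comp_of_convexOn [IsFiniteMeasure μ] (hM : Martingale M ℱ μ) {φ : ℝ → ℝ}
    (hφ : ConvexOn ℝ Set.univ φ) (hint : ∀ n, Integrable (φ ∘ M n) μ) :
    Submartingale (fun n => φ ∘ M n) ℱ μ := by
  have hφ' : Continuous φ := continuousOn_univ.1 (hφ.continuousOn isOpen_univ)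
  refine submartingale_nat (fun n => hφ'.comp_stronglyMeasurable (hM.1 n)) hint fun n => ?_
  filter_upwards [hM.2 n (n + 1) n.le_succ,
    hφ.map_condExp_le_of_finiteDimensional (ℱ.le n) (hM.integrable (n + 1)) (hint (n + 1))]
    with ω h₁ h₂
  rw [Function.comp_apply, ← h₁]
  exact h₂

theorem measureReal_exists_le_le_exp_mul_mgf [IsFiniteMeasure μ] (hM : Martingale M ℱ μ) {t : ℝ}
    (ht : 0 ≤ t) (hint : ∀ n, Integrable (fun ω => Real.exp (t * M n ω)) μ) (n : ℕ) (x : ℝ) :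
    μ.real {ω | ∃ k ≤ n, x ≤ M k ω} ≤ Real.exp (-t * x) * mgf (M n) μ t := by
  have hconvex : ConvexOn ℝ Set.univ fun y : ℝ => Real.exp (t * y) := by
    simpa using! convexOn_exp.comp_linearMap (t • LinearMap.id : ℝ →ₗ[ℝ] ℝ)
  have hsub : Submartingale (fun n ω => Real.exp (t * M n ω)) ℱ μ :=
    submartingale_comp_of_convexOn hM hconvex hint
  let c : ℝ≥0 := ⟨Real.exp (t * x), (Real.exp_pos _).le⟩
  set A : Set Ω := {ω | (c : ℝ) ≤ (range (n + 1)).sup' nonempty_range_add_one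
    fun k => Real.exp (t * M k ω)}
  have hA : {ω | ∃ k ≤ n, x ≤ M k ω} ⊆ A := by
    rintro ω ⟨k, hk, hxk⟩
    have hle : Real.exp (t * x) ≤ Real.exp (t * M k ω) := by gcongr
    exact hle.trans (le_sup' (fun k => Real.exp (t * M k ω)) (mem_range_succ_iff.2 hk))
  have hmax : Real.exp (t * x) * μ.real A ≤ ∫ ω in A, Real.exp (t * M n ω) ∂μ := by
    have h := ENNReal.toReal_mono ENNReal.ofReal_ne_top
      (maximal_ineq hsub (fun _ _ => (Real.exp_pos _).le) (ε := c) n)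
    rwa [ENNReal.toReal_mul, ENNReal.toReal_ofReal
      (integral_nonneg fun _ => (Real.exp_pos _).le)] at h
  calc μ.real {ω | ∃ k ≤ n, x ≤ M k ω} ≤ μ.real A := measureReal_mono hA
    _ = Real.exp (-t * x) * (Real.exp (t * x) * μ.real A) := by
        rw [← mul_assoc, ← Real.exp_add, neg_mul, neg_add_cancel, Real.exp_zero, one_mul]
    _ ≤ Real.exp (-t * x) * mgf (M n) μ t := by
        gcongr
        exact hmax.trans
          (setIntegral_le_integral (hint n) (.of_forall fun _ => (Real.exp_pos _).le))

theorem measureReal_exists_le_le_of_hasSubgaussianMGF [IsFiniteMeasure μ] (hM : Martingale M ℱ μ)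
    {c : ℕ → ℝ≥0} (hc : ∀ n, HasSubgaussianMGF (M n) (c n) μ) (n : ℕ) {x : ℝ} (hx : 0 ≤ x) :
    μ.real {ω | ∃ k ≤ n, x ≤ M k ω} ≤ Real.exp (-x ^ 2 / (2 * c n)) := by
  have ht : 0 ≤ x / c n := by positivity
  calc μ.real {ω | ∃ k ≤ n, x ≤ M k ω}
      ≤ Real.exp (-(x / c n) * x) * mgf (M n) μ (x / c n) :=
        measureReal_exists_le_le_exp_mul_mgf hM ht (fun k => (hc k).integrable_exp_mul _) n x
    _ ≤ Real.exp (-(x / c n) * x) * Real.exp (c n * (x / c n) ^ 2 / 2) := by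
        gcongr
        exact (hc n).mgf_le _
    _ = Real.exp (-x ^ 2 / (2 * c n)) := by
        rw [← Real.exp_add]
        congr 1
        rcases eq_or_ne (c n : ℝ) 0 with h | h
        · simp [h]
        · field_simp
          ring

/-- A tail bound at each single time is summable only for large `a`; with one event per dyadic block
the probabilities decay geometrically for every `a > 0`. -/
theorem ae_eventually_forall_dyadic_lt [IsFiniteMeasure μ] (hM : Martingale M ℱ μ) {c : ℝ≥0}
    (hc0 : 0 < c) (hc : ∀ n, HasSubgaussianMGF (M n) (n * c) μ) {a : ℝ} (ha : 0 < a) :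
    ∀ᵐ ω ∂μ, ∀ᶠ j : ℕ in Filter.atTop, ∀ n ≤ 2 ^ (j + 1),
      M n ω < a * √(2 ^ j * (j * Real.log 2)) := by
  set x : ℕ → ℝ := fun j => a * √(2 ^ j * (j * Real.log 2))
  set A : ℕ → Set Ω := fun j => {ω | ∃ n ≤ 2 ^ (j + 1), x j ≤ M n ω}
  have : 0 < Real.log 2 := Real.log_pos one_lt_two
  set r : ℝ := Real.exp (-(a ^ 2 * Real.log 2 / (4 * c)))
  have hr : r < 1 := Real.exp_lt_one_iff.2 (neg_neg_of_pos (by positivity))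
  have hA : ∀ j, μ (A j) ≤ ENNReal.ofReal (r ^ j) := fun j => by
    rw [← ofReal_measureReal, ← Real.exp_nat_mul]
    refine ENNReal.ofReal_le_ofReal ((measureReal_exists_le_le_of_hasSubgaussianMGF hM hc
      (2 ^ (j + 1)) (x := x j) (by positivity)).trans_eq (congrArg Real.exp ?_))
    rw [mul_pow, Real.sq_sqrt (by positivity)]
    push_cast
    field_simp
    ring
  have hsum : ∑' j, μ (A j) ≠ ⊤ := by
    refine ne_top_of_le_ne_top ?_ (ENNReal.tsum_le_tsum hA)
    rw [← ENNReal.ofReal_tsum_of_nonneg (fun j => by positivity)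
      (summable_geometric_of_lt_one (by positivity) hr)]
    exact ENNReal.ofReal_ne_top
  filter_upwards [ae_eventually_notMem hsum] with ω hω
  filter_upwards [hω] with j hj n hn
  by_contra! hle
  exact hj ⟨n, hn, hle⟩

theorem ae_eventually_le_mul_sqrt_mul_log [IsFiniteMeasure μ] (hM : Martingale M ℱ μ) {c : ℝ≥0}
    (hc0 : 0 < c) (hc : ∀ n, HasSubgaussianMGF (M n) (n * c) μ) {a : ℝ} (ha : 0 < a) :
    ∀ᵐ ω ∂μ, ∀ᶠ n : ℕ in Filter.atTop, M n ω ≤ a * √(n * Real.log n) := by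
  filter_upwards [ae_eventually_forall_dyadic_lt hM hc0 hc ha] with ω hω
  have hlog : Filter.Tendsto (Nat.log 2) Filter.atTop Filter.atTop :=
    Filter.tendsto_atTop_atTop_of_monotone (fun _ _ h => Nat.log_mono_right h) fun j =>
      ⟨2 ^ j, (Nat.log_pow one_lt_two j).ge⟩
  filter_upwards [hlog.eventually hω, Filter.eventually_ne_atTop 0] with n hn hn0
  have hpow : (2 : ℝ) ^ Nat.log 2 n ≤ n := by exact_mod_cast Nat.pow_log_le_self 2 hn0
  have hlogle : Nat.log 2 n * Real.log 2 ≤ Real.log n := by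
    rw [← Real.log_pow]
    exact Real.log_le_log (by positivity) hpow
  calc M n ω ≤ a * √(2 ^ Nat.log 2 n * (Nat.log 2 n * Real.log 2)) :=
        (hn n (Nat.lt_pow_succ_log_self one_lt_two n).le).le
    _ ≤ a * √(n * Real.log n) := by gcongr

end SubgaussianMartingale

section AffineRecursion

theorem sum_nonneg_of_mul_le_succ {ρ : ℝ} (hρ : -1 ≤ ρ) {d : ℕ → ℝ} (h0 : 0 ≤ d 0)
    (hd : ∀ k, ρ * d k ≤ d (k + 1)) (n : ℕ) : 0 ≤ ∑ k ∈ Finset.range n, d k := by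
  rcases le_total 0 ρ with hρ0 | hρ0
  · have hd0 (k : ℕ) : 0 ≤ d k := by
      induction k with
      | zero => exact h0
      | succ k ih => exact (mul_nonneg hρ0 ih).trans (hd k)
    exact Finset.sum_nonneg fun k _ => hd0 k
  · -- For `ρ ≤ 0` the terms may change sign, but each partial sum dominates a convex combination
    -- of the two preceding ones.
    induction n using Nat.twoStepInduction with
    | zero => simp
    | one => simpa using h0
    | more n ih₀ ih₁ =>
      calc 0 ≤ -ρ * ∑ k ∈ Finset.range n, d k + (1 + ρ) * ∑ k ∈ Finset.range (n + 1), d k :=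
            add_nonneg (mul_nonneg (neg_nonneg.2 hρ0) ih₀) (mul_nonneg (by linarith) ih₁)
        _ = ∑ k ∈ Finset.range (n + 1), d k + ρ * d n := by
            rw [Finset.sum_range_succ]
            ring
        _ ≤ ∑ k ∈ Finset.range (n + 2), d k := by
            rw [Finset.sum_range_succ _ (n + 1)]
            gcongr
            exact hd n

theorem sum_le_of_le_affine {δ b : ℝ} (hδ0 : 0 < δ) (hδ2 : δ ≤ 2) {q : ℕ → ℝ}
    (hq : ∀ k, q (k + 1) ≤ b + (1 - δ) * q k) (n : ℕ) :
    ∑ k ∈ Finset.range n, q k ≤ n * (b / δ) + (1 - (1 - δ) ^ n) / δ * (q 0 - b / δ) := by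
  set w : ℝ := b / δ
  have hw : b = δ * w := (mul_div_cancel₀ b hδ0.ne').symm
  have hgeom : ∑ k ∈ Finset.range n, (1 - δ) ^ k = (1 - (1 - δ) ^ n) / δ := by
    rw [eq_div_iff hδ0.ne', ← mul_neg_geom_sum, sub_sub_cancel, mul_comm]
  have hgap : 0 ≤ ∑ k ∈ Finset.range n, (w + (1 - δ) ^ k * (q 0 - w) - q k) := by
    refine sum_nonneg_of_mul_le_succ (ρ := 1 - δ) (by linarith) (by simp) (fun k => ?_) n
    linear_combination hq k + hw
  simp only [Finset.sum_sub_distrib, Finset.sum_add_distrib, ← Finset.sum_mul, hgeom,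
    Finset.sum_const, Finset.card_range, nsmul_eq_mul] at hgap
  exact sub_nonneg.1 hgap

end AffineRecursion

section ContractingDrift

/-- An adapted `[0, 1]`-valued process `D` whose conditional drift contracts at rate `δ` towards a
level at most `b / δ`. -/
structure HasContractingDrift {Ω : Type*} {mΩ : MeasurableSpace Ω} (μ : Measure Ω)
    (ℱ : Filtration ℕ mΩ) (δ b : ℝ) (D : ℕ → Ω → ℝ) : Prop where
  stronglyAdapted : StronglyAdapted ℱ D
  mem_Icc : ∀ k ω, D k ω ∈ Set.Icc 0 1
  condExp_succ_le : ∀ k, μ[D (k + 1) | ℱ k] ≤ᵐ[μ] fun ω => b + (1 - δ) * D k ω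

namespace HasContractingDrift

variable {Ω : Type*} {mΩ : MeasurableSpace Ω} {μ : Measure Ω} {ℱ : Filtration ℕ mΩ} {δ b : ℝ}
  {D : ℕ → Ω → ℝ}

theorem measurable (h : HasContractingDrift μ ℱ δ b D) (k : ℕ) : Measurable (D k) :=
  ((h.stronglyAdapted k).mono (ℱ.le k)).measurable

theorem memLp [IsFiniteMeasure μ] (h : HasContractingDrift μ ℱ δ b D) (k : ℕ) : MemLp (D k) 2 μ :=
  memLp_of_bounded (.of_forall (h.mem_Icc k)) (h.measurable k).aestronglyMeasurable 2

theorem integrable [IsFiniteMeasure μ] (h : HasContractingDrift μ ℱ δ b D) (k : ℕ) :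
    Integrable (D k) μ :=
  (h.memLp k).integrable one_le_two

theorem integral_succ_le [IsProbabilityMeasure μ] (h : HasContractingDrift μ ℱ δ b D) (k : ℕ) :
    ∫ ω, D (k + 1) ω ∂μ ≤ b + (1 - δ) * ∫ ω, D k ω ∂μ := by
  have hint : Integrable (fun ω => (1 - δ) * D k ω) μ := (h.integrable k).const_mul _
  calc ∫ ω, D (k + 1) ω ∂μ = ∫ ω, (μ[D (k + 1) | ℱ k]) ω ∂μ := (integral_condExp (ℱ.le k)).symm
    _ ≤ ∫ ω, (b + (1 - δ) * D k ω) ∂μ :=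
        integral_mono_ae integrable_condExp ((integrable_const b).add hint) (h.condExp_succ_le k)
    _ = b + (1 - δ) * ∫ ω, D k ω ∂μ := by
        rw [integral_add (integrable_const b) hint, integral_const_mul]
        simp

theorem average_integral_le [IsProbabilityMeasure μ] (h : HasContractingDrift μ ℱ δ b D)
    (hδ0 : 0 < δ) (hδ2 : δ ≤ 2) {n : ℕ} (hn : 1 ≤ n) :
    1 / (n : ℝ) * ∑ k ∈ Finset.range n, ∫ ω, D k ω ∂μ ≤
      b / δ + (1 - (1 - δ) ^ n) / (n * δ) * (∫ ω, D 0 ω ∂μ - b / δ) := by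
  have : (0 : ℝ) < n := by exact_mod_cast hn
  calc 1 / (n : ℝ) * ∑ k ∈ Finset.range n, ∫ ω, D k ω ∂μ
      ≤ 1 / n * (n * (b / δ) + (1 - (1 - δ) ^ n) / δ * (∫ ω, D 0 ω ∂μ - b / δ)) := by
        gcongr
        exact sum_le_of_le_affine hδ0 hδ2 h.integral_succ_le n
    _ = _ := by field_simp

variable [IsProbabilityMeasure μ]

theorem martingale (h : HasContractingDrift μ ℱ δ b D) :
    Martingale (martingalePart D ℱ μ) ℱ μ :=
  martingale_martingalePart h.stronglyAdapted h.integrable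

theorem martingalePart_succ_sub (h : HasContractingDrift μ ℱ δ b D) (k : ℕ) :
    (fun ω => martingalePart D ℱ μ (k + 1) ω - martingalePart D ℱ μ k ω) =ᵐ[μ]
      fun ω => D (k + 1) ω - (μ[D (k + 1) | ℱ k]) ω := by
  have hcond : μ[D (k + 1) - D k | ℱ k] =ᵐ[μ] μ[D (k + 1) | ℱ k] - D k := by
    refine (condExp_sub (h.integrable (k + 1)) (h.integrable k) (ℱ k)).trans ?_
    rw [condExp_of_stronglyMeasurable (ℱ.le k) (h.stronglyAdapted k) (h.integrable k)]
  filter_upwards [hcond] with ω hω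
  simp only [martingalePart, predictablePart_add_one, Pi.sub_apply, Pi.add_apply, hω]
  ring

theorem abs_martingalePart_succ_sub_le (h : HasContractingDrift μ ℱ δ b D) (k : ℕ) :
    ∀ᵐ ω ∂μ, |martingalePart D ℱ μ (k + 1) ω - martingalePart D ℱ μ k ω| ≤ 1 := by
  have hle : μ[D (k + 1) | ℱ k] ≤ᵐ[μ] fun _ => (1 : ℝ) := by
    rw [← condExp_const (μ := μ) (ℱ.le k) (1 : ℝ)]
    exact condExp_mono (h.integrable (k + 1)) (integrable_const 1)
      (.of_forall fun ω => (h.mem_Icc (k + 1) ω).2)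
  filter_upwards [h.martingalePart_succ_sub k, hle,
    condExp_nonneg (m := ℱ k) (.of_forall fun ω => (h.mem_Icc (k + 1) ω).1)] with ω hω h₁ h₀
  rw [hω]
  exact abs_sub_le_of_nonneg_of_le (h.mem_Icc _ ω).1 (h.mem_Icc _ ω).2 h₀ h₁

theorem mul_sum_le_martingalePart_add (h : HasContractingDrift μ ℱ δ b D) :
    ∀ᵐ ω ∂μ, ∀ n : ℕ,
      δ * ∑ k ∈ Finset.range n, D k ω ≤ martingalePart D ℱ μ n ω + n * b := by
  filter_upwards [ae_all_iff.2 h.martingalePart_succ_sub, ae_all_iff.2 h.condExp_succ_le]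
    with ω hincr hdrift n
  have hsum : δ * ∑ k ∈ Finset.range n, D k ω + D n ω ≤ martingalePart D ℱ μ n ω + n * b := by
    induction n with
    | zero => simp [martingalePart_zero]
    | succ n ih =>
      rw [Finset.sum_range_succ, Nat.cast_succ]
      linarith [hincr n, hdrift n]
  linarith [(h.mem_Icc n ω).1]

theorem average_sub_le (h : HasContractingDrift μ ℱ δ b D) (hδ : 0 < δ) :
    ∀ᵐ ω ∂μ, ∀ n : ℕ, 1 ≤ n →
      1 / (n : ℝ) * ∑ k ∈ Finset.range n, D k ω - b / δ ≤ martingalePart D ℱ μ n ω / (n * δ) := by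
  filter_upwards [h.mul_sum_le_martingalePart_add] with ω hω n hn
  have : (0 : ℝ) < n := by exact_mod_cast hn
  calc 1 / (n : ℝ) * ∑ k ∈ Finset.range n, D k ω - b / δ
      = (δ * ∑ k ∈ Finset.range n, D k ω - n * b) / (n * δ) := by field_simp
    _ ≤ martingalePart D ℱ μ n ω / (n * δ) := by
        gcongr
        exact sub_le_iff_le_add.2 (hω n)

theorem memLp_martingalePart (h : HasContractingDrift μ ℱ δ b D) (n : ℕ) :
    MemLp (martingalePart D ℱ μ n) 2 μ := by
  induction n with
  | zero =>
    rw [martingalePart_zero]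
    exact h.memLp 0
  | succ n ih =>
    have hincr : MemLp (martingalePart D ℱ μ (n + 1) - martingalePart D ℱ μ n) 2 μ :=
      .of_bound ((h.martingale.integrable _).sub (h.martingale.integrable _)).1 1
        (h.abs_martingalePart_succ_sub_le n)
    simpa using hincr.add ih

theorem integral_sq_martingalePart_le (h : HasContractingDrift μ ℱ δ b D) (n : ℕ) :
    ∫ ω, martingalePart D ℱ μ n ω ^ 2 ∂μ ≤ 1 + n / 4 := by
  have hinit : ∫ ω, martingalePart D ℱ μ 0 ω ^ 2 ∂μ ≤ 1 := by
    rw [martingalePart_zero]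
    calc ∫ ω, D 0 ω ^ 2 ∂μ ≤ ∫ _, 1 ∂μ :=
          integral_mono (h.memLp 0).integrable_sq (integrable_const 1) fun ω =>
            pow_le_one₀ (h.mem_Icc 0 ω).1 (h.mem_Icc 0 ω).2
      _ = 1 := by simp
  have hincr (k : ℕ) :
      ∫ ω, (martingalePart D ℱ μ (k + 1) ω - martingalePart D ℱ μ k ω) ^ 2 ∂μ ≤ 1 / 4 := by
    calc ∫ ω, (martingalePart D ℱ μ (k + 1) ω - martingalePart D ℱ μ k ω) ^ 2 ∂μ
        = ∫ ω, (D (k + 1) ω - (μ[D (k + 1) | ℱ k]) ω) ^ 2 ∂μ :=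
          integral_congr_ae <| (h.martingalePart_succ_sub k).mono fun ω hω =>
            congrArg (· ^ 2) hω
      _ ≤ variance (D (k + 1)) μ := integral_sub_condExp_sq_le_variance (ℱ.le k) (h.memLp _)
      _ ≤ ((1 - 0) / 2) ^ 2 :=
          variance_le_sq_of_bounded (.of_forall (h.mem_Icc _)) (h.measurable _).aemeasurable
      _ = 1 / 4 := by norm_num
  calc ∫ ω, martingalePart D ℱ μ n ω ^ 2 ∂μ
      = ∫ ω, martingalePart D ℱ μ 0 ω ^ 2 ∂μ + ∑ k ∈ Finset.range n,
          ∫ ω, (martingalePart D ℱ μ (k + 1) ω - martingalePart D ℱ μ k ω) ^ 2 ∂μ :=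
        integral_sq_martingale h.martingale h.memLp_martingalePart n
    _ ≤ 1 + ∑ _k ∈ Finset.range n, (1 / 4 : ℝ) := by
        gcongr with k
        exact hincr k
    _ = 1 + n / 4 := by
        rw [Finset.sum_const, Finset.card_range, nsmul_eq_mul, mul_one_div]

theorem integral_max_average_sub_sq_le (h : HasContractingDrift μ ℱ δ b D) (hδ : 0 < δ) {n : ℕ}
    (hn : 1 ≤ n) :
    ∫ ω, max (1 / (n : ℝ) * ∑ k ∈ Finset.range n, D k ω - b / δ) 0 ^ 2 ∂μ ≤
      (1 + n / 4) / (n * δ) ^ 2 := by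
  have hpt : ∀ᵐ ω ∂μ, max (1 / (n : ℝ) * ∑ k ∈ Finset.range n, D k ω - b / δ) 0 ^ 2 ≤
      martingalePart D ℱ μ n ω ^ 2 / (n * δ) ^ 2 := by
    filter_upwards [h.average_sub_le hδ] with ω hω
    rw [← div_pow, ← sq_abs (_ / _)]
    gcongr
    exact max_le ((hω n hn).trans (le_abs_self _)) (abs_nonneg _)
  calc ∫ ω, max (1 / (n : ℝ) * ∑ k ∈ Finset.range n, D k ω - b / δ) 0 ^ 2 ∂μ
      ≤ ∫ ω, martingalePart D ℱ μ n ω ^ 2 / (n * δ) ^ 2 ∂μ :=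
        integral_mono_of_nonneg (.of_forall fun _ => sq_nonneg _)
          ((h.memLp_martingalePart n).integrable_sq.div_const _) hpt
    _ ≤ (1 + n / 4) / (n * δ) ^ 2 := by
        rw [integral_div]
        gcongr
        exact h.integral_sq_martingalePart_le n

variable [StandardBorelSpace Ω]

theorem hasSubgaussianMGF_martingalePart_sub (h : HasContractingDrift μ ℱ δ b D) (n : ℕ) :
    HasSubgaussianMGF (martingalePart D ℱ μ n - martingalePart D ℱ μ 0) n μ := by
  simpa using hasSubgaussianMGF_sub_of_abs_sub_le h.martingale (c := fun _ => 1)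
    h.abs_martingalePart_succ_sub_le n

theorem measureReal_le_average_le (h : HasContractingDrift μ ℱ δ b D) (hδ : 0 < δ) {n : ℕ}
    (hn : 1 ≤ n) {lam : ℝ} (hlam : 0 ≤ lam) :
    μ.real {ω | b / δ + D 0 ω / (n * δ) + lam / √n ≤
        1 / (n : ℝ) * ∑ k ∈ Finset.range n, D k ω} ≤ Real.exp (-(δ ^ 2 / 2) * lam ^ 2) := by
  have hn0 : (0 : ℝ) < n := by exact_mod_cast hn
  set M : ℕ → Ω → ℝ := martingalePart D ℱ μ
  have hevent : ∀ᵐ ω ∂μ, b / δ + D 0 ω / (n * δ) + lam / √n ≤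
      1 / (n : ℝ) * ∑ k ∈ Finset.range n, D k ω → δ * lam * √n ≤ (M n - M 0) ω := by
    filter_upwards [h.average_sub_le hδ] with ω hω hle
    have hM0 : M 0 ω = D 0 ω := congrFun martingalePart_zero ω
    have hquot : lam / √n ≤ (M n ω - D 0 ω) / (n * δ) := by
      rw [sub_div]
      linarith [hω n hn]
    calc δ * lam * √n = lam / √n * (n * δ) := by
          nth_rw 3 [← Real.mul_self_sqrt hn0.le]
          field_simp
      _ ≤ M n ω - D 0 ω := (le_div_iff₀ (by positivity)).1 hquot
      _ = (M n - M 0) ω := by rw [Pi.sub_apply, hM0]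
  calc _ ≤ μ.real {ω | δ * lam * √n ≤ (M n - M 0) ω} :=
        ENNReal.toReal_mono (measure_ne_top _ _) (measure_mono_ae hevent)
    _ ≤ Real.exp (-(δ * lam * √n) ^ 2 / (2 * n)) :=
        (h.hasSubgaussianMGF_martingalePart_sub n).measure_ge_le (by positivity)
    _ = Real.exp (-(δ ^ 2 / 2) * lam ^ 2) := by
        rw [mul_pow _ (√n), Real.sq_sqrt hn0.le]
        congr 1
        field_simp

theorem ae_eventually_martingalePart_sub_le (h : HasContractingDrift μ ℱ δ b D) {a : ℝ}
    (ha : 0 < a) : ∀ᵐ ω ∂μ, ∀ᶠ n : ℕ in Filter.atTop,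
      martingalePart D ℱ μ n ω - martingalePart D ℱ μ 0 ω ≤ a * √(n * Real.log n) := by
  have hinit : Martingale (fun _ => martingalePart D ℱ μ 0) ℱ μ := by
    rw [martingalePart_zero]
    exact martingale_const_fun ℱ μ (h.stronglyAdapted 0) (h.integrable 0)
  exact ae_eventually_le_mul_sqrt_mul_log (h.martingale.sub hinit) zero_lt_one
    (fun n => by simpa using h.hasSubgaussianMGF_martingalePart_sub n) ha

theorem exists_ae_average_le (h : HasContractingDrift μ ℱ δ b D) (hδ : 0 < δ) :
    ∃ K : Ω → ℝ, Measurable K ∧ ∀ᵐ ω ∂μ, ∀ n : ℕ, 1 ≤ n →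
      1 / (n : ℝ) * ∑ k ∈ Finset.range n, D k ω ≤ b / δ + K ω / n + 2 * √(Real.log n / n) := by
  set excess : ℕ → Ω → ℝ := fun n ω => n * (1 / (n : ℝ) * ∑ k ∈ Finset.range n, D k ω - b / δ -
    2 * √(Real.log n / n))
  have hmeas (n : ℕ) : Measurable (excess n) :=
    ((((Finset.measurable_fun_sum _ fun k _ => h.measurable k).const_mul _).sub_const _).sub_const
      _).const_mul _
  refine ⟨fun ω => ⨆ n, excess n ω, .iSup hmeas, ?_⟩
  filter_upwards [h.average_sub_le hδ,
    h.ae_eventually_martingalePart_sub_le (a := 2 * δ) (by positivity)] with ω havg hgrowth n hn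
  have hbound : ∀ᶠ n in Filter.atTop, excess n ω ≤ 1 / δ := by
    filter_upwards [hgrowth, Filter.eventually_ge_atTop 1] with n hn hn1
    have hn0 : (0 : ℝ) < n := by exact_mod_cast hn1
    have hsqrt : √(n * Real.log n) = n * √(Real.log n / n) := by
      rw [← Real.sqrt_sq hn0.le, ← Real.sqrt_mul (sq_nonneg _), Real.sqrt_sq hn0.le]
      congr 1
      field_simp
    have hM : martingalePart D ℱ μ n ω ≤ 1 + 2 * δ * (n * √(Real.log n / n)) := by
      rw [martingalePart_zero, hsqrt] at hn
      linarith [(h.mem_Icc 0 ω).2]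
    calc excess n ω ≤ n * ((1 + 2 * δ * (n * √(Real.log n / n))) / (n * δ) -
          2 * √(Real.log n / n)) := by
          refine mul_le_mul_of_nonneg_left (sub_le_sub_right ((havg n hn1).trans ?_) _) hn0.le
          gcongr
      _ = 1 / δ := by
          field_simp
          ring
  have hbdd : BddAbove (Set.range fun n => excess n ω) :=
    Filter.IsBoundedUnder.bddAbove_range ⟨1 / δ, Filter.eventually_map.2 hbound⟩
  have hn0 : (0 : ℝ) < n := by exact_mod_cast hn
  have hle : 1 / (n : ℝ) * ∑ k ∈ Finset.range n, D k ω - b / δ - 2 * √(Real.log n / n) ≤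
      (⨆ n, excess n ω) / n := by
    rw [le_div_iff₀' hn0]
    exact le_ciSup hbdd n
  linarith

end HasContractingDrift

end ContractingDrift

section Disagreement

variable {E : Type*} [MeasurableSpace E] [MeasurableEq E]

theorem measurableSet_fst_ne_snd : MeasurableSet {p : E × E | p.1 ≠ p.2} :=
  (measurableSet_eq_fun measurable_fst measurable_snd).compl

theorem IsChainCoupling.integral_disagree {Ω : Type*} [MeasurableSpace Ω] {μ : Measure Ω}
    {κ η : Kernel E E} {ν : Measure (E × E)} {X Y : ℕ → Ω → E} (h : IsChainCoupling μ κ η ν X Y)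
    (k : ℕ) : ∫ ω, disagree X Y k ω ∂μ = μ.real {ω | X k ω ≠ Y k ω} :=
  integral_indicator_one (measurableSet_eq_fun (h.measurable_left k) (h.measurable_right k)).compl

theorem hasContractingDrift_disagree (Q : Kernel (E × E) (E × E)) [IsMarkovKernel Q]
    (ν : Measure (E × E)) [IsProbabilityMeasure ν] {δ b : ℝ}
    (hmeet : ∀ x, (Q (x, x)).real {q | q.1 ≠ q.2} ≤ b)
    (hdiff : ∀ x y, x ≠ y → (Q (x, y)).real {q | q.1 ≠ q.2} ≤ b + (1 - δ)) :
    HasContractingDrift (markovPathMeasure Q ν) (Filtration.piLE (X := fun _ => E × E)) δ b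
      (disagree (fun k ω => (ω k).1) (fun k ω => (ω k).2)) where
  stronglyAdapted k :=
    (stronglyMeasurable_const (b := (1 : ℝ))).indicator
      (measurable_eval_piLE k measurableSet_fst_ne_snd)
  mem_Icc k ω := ⟨Set.indicator_nonneg (fun _ _ => zero_le_one) _,
    Set.indicator_le_self' (fun _ _ => zero_le_one) _⟩
  condExp_succ_le k := by
    refine (markovPathMeasure_condExp_succ Q ν k measurableSet_fst_ne_snd).le.trans
      (.of_forall fun ω => ?_)
    rcases eq_or_ne (ω k).1 (ω k).2 with heq | hne
    · have hD : disagree (fun k (ω : ℕ → E × E) => (ω k).1) (fun k ω => (ω k).2) k ω = 0 :=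
        Set.indicator_of_notMem (not_not.2 heq) _
      have hω : ω k = ((ω k).1, (ω k).1) := Prod.ext rfl heq.symm
      simpa only [hD, mul_zero, add_zero, ← hω] using hmeet (ω k).1
    · have hD : disagree (fun k (ω : ℕ → E × E) => (ω k).1) (fun k ω => (ω k).2) k ω = 1 :=
        Set.indicator_of_mem hne _
      simpa only [hD, mul_one] using hdiff _ _ hne

end Disagreement

theorem one_add_div_four_div_sq_le {a δ x : ℝ} (hδ0 : 0 < δ) (hδa : δ ≤ 2 * a) (hx : 0 < x) :
    (1 + x / 4) / (x * δ) ^ 2 ≤ 2 / x ^ 2 * (1 / δ ^ 2) + 2 / x * (a ^ 2 / δ ^ 4) := by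
  calc (1 + x / 4) / (x * δ) ^ 2 = 1 / x ^ 2 * (1 / δ ^ 2) + 1 / x * ((δ / 2) ^ 2 / δ ^ 4) := by
        field_simp
        ring
    _ ≤ 2 / x ^ 2 * (1 / δ ^ 2) + 2 / x * (a ^ 2 / δ ^ 4) := by
        gcongr <;> linarith

theorem mainTheorem2 {E : Type u} [TopologicalSpace E] [PolishSpace E] [MeasurableSpace E]
    [BorelSpace E] (P Pε : Kernel E E) [IsMarkovKernel P] [IsMarkovKernel Pε]
    (α ε : ℝ) (hα0 : 0 < α) (hα1 : α < 1) (hε0 : 0 < ε) (hεα : ε < α)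
    (localApprox : ∀ x : E, tvDist (Pε x) (P x) ≤ ε)
    (crossDoeblin : ∀ x y : E, tvDist (Pε x) (P y) ≤ 1 - α)
    (ν : Measure (E × E)) [IsProbabilityMeasure ν] :
    ∃ (Ω : Type u) (_ : MeasurableSpace Ω) (μ : Measure Ω) (_ : IsProbabilityMeasure μ)
      (X Xε : ℕ → Ω → E),
      IsChainCoupling μ P Pε ν X Xε ∧
      (∀ n : ℕ, 1 ≤ n →
        (1 / (n : ℝ)) * ∑ k ∈ Finset.range n, μ.real {ω | X k ω ≠ Xε k ω} ≤
          ε / (α + ε) + (1 - (1 - α - ε) ^ n) / (n * (α + ε)) *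
            (μ.real {ω | X 0 ω ≠ Xε 0 ω} - ε / (α + ε))) ∧
      (∃ K : Ω → ℝ, Measurable K ∧ ∀ᵐ ω ∂μ, ∀ n : ℕ, 1 ≤ n →
        disagreeFrac X Xε n ω ≤
          ε / (α + ε) + K ω / n + 2 * Real.sqrt (Real.log n / n)) ∧
      (∀ n : ℕ, 1 ≤ n →
        ∫ ω, (max (disagreeFrac X Xε n ω - ε / (α + ε)) 0) ^ 2 ∂μ ≤
          2 / (n : ℝ) ^ 2 * (1 / (α + ε) ^ 2) + 2 / (n : ℝ) * (α ^ 2 / (α + ε) ^ 4)) ∧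
      (∀ n : ℕ, 1 ≤ n → ∀ lam : ℝ, 0 < lam →
        μ.real {ω | ε / (α + ε) + disagree X Xε 0 ω / (n * (α + ε)) + lam / Real.sqrt n ≤
            disagreeFrac X Xε n ω} ≤
          Real.exp (-((α + ε) ^ 2 / 2) * lam ^ 2)) := by
  have hδ : 0 < α + ε := add_pos hα0 hε0
  let Q : Kernel (E × E) (E × E) :=
    maximalCoupling (P.comap Prod.fst measurable_fst) (Pε.comap Prod.snd measurable_snd)
  have hQ (x y : E) : (Q (x, y)).real {q | q.1 ≠ q.2} ≤ tvDist (Pε y) (P x) := by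
    rw [tvDist_comm]
    exact maximalCoupling_real_ne_le_tvDist _ _ (x, y)
  have hcoupling := isChainCoupling_markovPathMeasure (Q := Q)
    (maximalCoupling_fst _ _) (maximalCoupling_snd _ _) ν
  have hdrift := hasContractingDrift_disagree Q ν (δ := α + ε) (b := ε)
    (fun x => (hQ x x).trans (localApprox x))
    (fun x y _ => (hQ x y).trans ((crossDoeblin y x).trans_eq (by ring)))
  refine ⟨ℕ → E × E, inferInstance, markovPathMeasure Q ν, inferInstance, _, _, hcoupling,
    fun n hn => ?_, hdrift.exists_ae_average_le hδ,
    fun n hn => (hdrift.integral_max_average_sub_sq_le hδ hn).trans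
      (one_add_div_four_div_sq_le hδ (by linarith) (by exact_mod_cast hn)),
    fun n hn lam hlam => hdrift.measureReal_le_average_le hδ hn hlam.le⟩
  simpa only [hcoupling.integral_disagree, sub_sub] using
    hdrift.average_integral_le hδ (by linarith) hn
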